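/- Let $\alpha_0<\alpha<\beta<\beta_0$ be real numbers, let $K,G,L\in C^\infty(]\alpha_0,\beta_0[)$ be positive on $]\alpha_0,\beta_0[$, and let $h,H\in[0,\infty]$. Consider the Sturm--Liouville eigenvalue problem $$\frac{d}{dx}\Big(K\frac{dV}{dx}\Big)+(\rho\,G-L)V=0\ \text{ on } [\alpha,\beta],\qquad \Big(K\frac{dV}{dx}-hV\Big)(\alpha)=0,\qquad \Big(K\frac{dV}{dx}+HV\Big)(\beta)=0,$$ where for $h=\infty$ (resp. $H=\infty$) the boundary condition is the Dirichlet condition $V(\alpha)=0$ (resp. $V(\beta)=0$). Let $\rho_1<\rho_2<\cdots$ be its eigenvalues in increasing order and, for each $j\ge 1$, let $V_j$ be an eigenfunction associated with $\rho_j$. Let $1\le m\le n$, let $A_m,\dots,A_n$ be real numbers, not all zero, and let $$Y=\sum_{p=m}^{n}A_pV_p .$$ Then $Y$ has only finitely many zeros in $]\alpha,\beta[$, and $Y$ changes sign at least $m-1$ times in $]\alpha,\beta[$: there are at least $m-1$ points $\xi\in\,]\alpha,\beta[$ at which $Y$ changes sign, that is, such that $Y$ has a constant strict sign just to the left of $\xi$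 and the opposite strict sign just to the right of $\xi$. Likewise, the number of zeros of $Y$ of odd multiplicity in $]\alpha,\beta[$ is at least $m-1$, where the multiplicity of a zero $\xi$ is the least $p$ with $\frac{d^pY}{dx^p}(\xi)\neq 0$. -/

import Mathlib

open scoped ContDiff

namespace SturmLiouville

/-- Boundary condition `(K V' - h V)(α) = 0`, read as the Dirichlet condition `V(α) = 0` when
`h = ∞`. -/
def LeftBC (K : ℝ → ℝ) (α β : ℝ) (h : ENNReal) (V : ℝ → ℝ) : Prop :=
  (h ≠ ⊤ → K α * derivWithin V (Set.Icc α β) α - h.toReal * V α = 0) ∧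
  (h = ⊤ → V α = 0)

/-- Boundary condition `(K V' + H V)(β) = 0`, read as the Dirichlet condition `V(β) = 0` when
`H = ∞`. -/
def RightBC (K : ℝ → ℝ) (α β : ℝ) (H : ENNReal) (V : ℝ → ℝ) : Prop :=
  (H ≠ ⊤ → K β * derivWithin V (Set.Icc α β) β + H.toReal * V β = 0) ∧
  (H = ⊤ → V β = 0)

/-- `V` is an eigenfunction, for the eigenvalue `ρ`, of the problem `(K V')' + (ρ G - L) V = 0`
on `[α, β]` with the two boundary conditions above. Only the restriction of `V` to `[α, β]`
matters. -/
structure IsEigenfunction (K G L : ℝ → ℝ) (α β : ℝ) (h H : ENNReal) (ρ : ℝ) (V : ℝ → ℝ) :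
    Prop where
  contDiffOn : ContDiffOn ℝ 2 V (Set.Icc α β)
  nontrivial : ∃ x ∈ Set.Icc α β, V x ≠ 0
  equation : ∀ x ∈ Set.Icc α β,
    derivWithin (fun y => K y * derivWithin V (Set.Icc α β) y) (Set.Icc α β) x
      + (ρ * G x - L x) * V x = 0
  leftBC : LeftBC K α β h V
  rightBC : RightBC K α β H V

/-- `ρ` is an eigenvalue of the problem. -/
def IsEigenvalue (K G L : ℝ → ℝ) (α β : ℝ) (h H : ENNReal) (ρ : ℝ) : Prop :=
  ∃ V : ℝ → ℝ, IsEigenfunction K G L α β h H ρ V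

/-- `ρ` is the `j`-th eigenvalue in increasing order (`j = 1, 2, …`): it is an eigenvalue and
exactly `j - 1` eigenvalues are smaller than it. -/
def IsNthEigenvalue (K G L : ℝ → ℝ) (α β : ℝ) (h H : ENNReal) (j : ℕ) (ρ : ℝ) : Prop :=
  IsEigenvalue K G L α β h H ρ ∧
    {r : ℝ | r < ρ ∧ IsEigenvalue K G L α β h H r}.encard + 1 = (j : ℕ∞)

/-- `V` is a `j`-th eigenfunction: an eigenfunction for the `j`-th eigenvalue. -/
def IsNthEigenfunction (K G L : ℝ → ℝ) (α β : ℝ) (h H : ENNReal) (j : ℕ) (V : ℝ → ℝ) : Prop :=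
  ∃ ρ : ℝ, IsNthEigenvalue K G L α β h H j ρ ∧ IsEigenfunction K G L α β h H ρ V

/-- The zeros of `f` in `]α, β[`. -/
def zeros (f : ℝ → ℝ) (α β : ℝ) : Set ℝ :=
  {ξ | ξ ∈ Set.Ioo α β ∧ f ξ = 0}

/-- The points of `]α, β[` at which `f` changes sign: `f` has a constant strict sign just to the
left of `ξ`, and the opposite strict sign just to the right of `ξ`. -/
def signChangePoints (f : ℝ → ℝ) (α β : ℝ) : Set ℝ :=
  {ξ | ξ ∈ Set.Ioo α β ∧
    ∃ ε > 0, ∀ x ∈ Set.Ioo (ξ - ε) ξ, ∀ y ∈ Set.Ioo ξ (ξ + ε), f x * f y < 0}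

/-- The multiplicity of `ξ` as a zero of `f`: the least `p` such that the `p`-th derivative of `f`
does not vanish at `ξ` (and `0` when there is none). -/
noncomputable def zeroMultiplicity (f : ℝ → ℝ) (ξ : ℝ) : ℕ :=
  sInf {p : ℕ | iteratedDeriv p f ξ ≠ 0}

/-- The number of sign changes of `f` in `]α, β[`, as the number of its zeros of odd
multiplicity, for a function with finitely many zeros in `]α, β[`. -/
noncomputable def numSignChanges (f : ℝ → ℝ) (α β : ℝ) : ℕ :=
  {ξ | ξ ∈ zeros f α β ∧ Odd (zeroMultiplicity f ξ)}.ncard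

/-- The linear combination `A_m V_m + ⋯ + A_n V_n`. -/
noncomputable def linComb (m n : ℕ) (A : ℕ → ℝ) (V : ℕ → ℝ → ℝ) : ℝ → ℝ :=
  fun x => ∑ j ∈ Finset.Icc m n, A j * V j x

end SturmLiouville

/-!
# Sign changes of linear combinations of Sturm–Liouville eigenfunctions

If `Y` solves `(K Y')' + G F - L Y = 0`, then `F` alternates in sign at least as often as `Y`.
Applied repeatedly to `∑ A j * (r i / r j) ^ N * V j`, which tends to `A i * V i` for the lowest
index `i` with `A i ≠ 0`, this bounds the sign changes of `∑ A j * V j` from below by those of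
`V i`, which are counted by Sturm's comparison theorem.
-/

namespace SturmLiouville

open Set Filter Topology

/-! ### Sign patterns of real functions -/

/-! Sign changes are counted through alternations: `k + 1` points of alternating sign force `k` sign
changes. Suppose `(K Y')' + G F - L Y = 0`. On a maximal interval where `Y > 0`, the flux `K Y'` is
nonnegative at the left end and nonpositive at the right end, by the boundary condition if the end
is not a zero of `Y`. It cannot be strictly increasing, so, as `L > 0`, the source `F` is positive
somewhere there. Hence `F` alternates at least as often as `Y` (`IsSolution.alternates_source`).

For `Y = ∑ A j * V j` the source is `∑ A j * r j * V j`: multiplying the coefficients by the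
eigenvalues loses no alternation. Conversely, dividing by them many times and rescaling leaves in
the limit only the component of lowest index `i ≥ m`, and finitely many strict signs survive in the
approximants (`Alternates.sum_of_lowest`). Sturm comparison gives `V i` at least `i` alternating
points (`IsNthEigenvalue.alternates`); no exact count of zeros is needed.

Counting zeros of odd multiplicity requires that `Y` have no zero of infinite order. At such a zero
all iterated sources are flat too, and a Vandermonde argument shows that each component with `A j ≠
0` has zero Cauchy data (`exists_iteratedDerivWithin_sum_ne_zero`). -/

/-- Near a zero of finite order, a smooth function has the sign of its leading Taylor term. -/
theorem eventually_pos_leading_term_mul {f : ℝ → ℝ} {s : Set ℝ} {ξ : ℝ} {p : ℕ} (hs : Convex ℝ s)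
    (hξ : ξ ∈ s) (hf : ContDiffOn ℝ ∞ f s) (hp : iteratedDerivWithin p f s ξ ≠ 0)
    (hlt : ∀ q < p, iteratedDerivWithin q f s ξ = 0) :
    ∀ᶠ x in 𝓝[s] ξ, x ≠ ξ → 0 < iteratedDerivWithin p f s ξ * (x - ξ) ^ p * f x := by
  have ht := taylor_isLittleO hs hξ (hf.of_le (show ((p : ℕ) : WithTop ℕ∞) ≤ ∞ from
    mod_cast le_top))
  have hev (x : ℝ) : taylorWithinEval f p s ξ x
      = iteratedDerivWithin p f s ξ / p.factorial * (x - ξ) ^ p := by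
    rw [taylor_within_apply, Finset.sum_range_succ, Finset.sum_eq_zero, zero_add, smul_eq_mul]
    · ring
    · intro q hq
      rw [hlt q (Finset.mem_range.1 hq), smul_zero]
  have hfac : (0 : ℝ) < p.factorial := by positivity
  set c := iteratedDerivWithin p f s ξ
  have hd : c / p.factorial ≠ 0 := div_ne_zero hp hfac.ne'
  -- A remainder of at most half the leading term cannot change its sign.
  filter_upwards [ht.bound (half_pos (abs_pos.2 hd))] with x hx hne
  rw [hev, Real.norm_eq_abs, Real.norm_eq_abs] at hx
  have hu : (x - ξ) ^ p ≠ 0 := pow_ne_zero _ (sub_ne_zero.2 hne)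
  set u := (x - ξ) ^ p
  have hc : c = p.factorial * (c / p.factorial) := by field_simp
  set d := c / p.factorial
  have hdu : 0 < |d * u| := abs_pos.2 (mul_ne_zero hd hu)
  have h1 : |f x - d * u| ≤ |d * u| / 2 := by rw [abs_mul]; linarith
  have h2 : 0 < d * u * f x := by
    have h3 : |d * u * (f x - d * u)| ≤ |d * u| * (|d * u| / 2) := by
      rw [abs_mul]; gcongr
    have h4 := neg_abs_le (d * u * (f x - d * u))
    have h5 : |d * u| * |d * u| = d * u * (d * u) := abs_mul_abs_self _
    nlinarith [mul_pos hdu hdu]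
  rw [hc]
  calc 0 < p.factorial * (d * u * f x) := mul_pos hfac h2
    _ = _ := by ring

/-- `f` takes values of alternating strict signs at `k` increasing points of `[α, β]`. -/
def Alternates (f : ℝ → ℝ) (α β : ℝ) (k : ℕ) : Prop :=
  ∃ x : ℕ → ℝ, (∀ i < k, x i ∈ Icc α β) ∧ (∀ i < k, f (x i) ≠ 0) ∧
    ∀ i, i + 1 < k → x i < x (i + 1) ∧ f (x i) * f (x (i + 1)) < 0

theorem Alternates.mono {f : ℝ → ℝ} {α β : ℝ} {k l : ℕ} (hf : Alternates f α β l) (hkl : k ≤ l) :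
    Alternates f α β k := by
  obtain ⟨x, h1, h2, h3⟩ := hf
  exact ⟨x, fun i hi => h1 i (by omega), fun i hi => h2 i (by omega), fun i hi => h3 i (by omega)⟩

/-- `]a, b[` is a maximal subinterval of `[α, β]` on which `f > 0`, up to the possible inclusion
of `α` and `β`. -/
structure IsPosInterval (f : ℝ → ℝ) (α β a b : ℝ) : Prop where
  le_left : α ≤ a
  lt : a < b
  right_le : b ≤ β
  pos : ∀ t ∈ Ioo a b, 0 < f t
  left : f a = 0 ∨ a = α
  right : f b = 0 ∨ b = β

theorem IsPosInterval.mem_Icc {f : ℝ → ℝ} {α β a b x : ℝ} (h : IsPosInterval f α β a b)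
    (hx : x ∈ Icc a b) : x ∈ Icc α β :=
  ⟨h.le_left.trans hx.1, hx.2.trans h.right_le⟩

theorem IsPosInterval.nonneg {f : ℝ → ℝ} {α β a b x : ℝ} (h : IsPosInterval f α β a b)
    (hf : ContinuousOn f (Icc α β)) (hx : x ∈ Icc a b) : 0 ≤ f x := by
  have : (𝓝[Ioo a b] x).NeBot := by
    rwa [← mem_closure_iff_nhdsWithin_neBot, closure_Ioo h.lt.ne]
  have hc : ContinuousWithinAt f (Ioo a b) x :=
    (hf x (h.mem_Icc hx)).mono fun t ht => h.mem_Icc ⟨ht.1.le, ht.2.le⟩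
  exact ge_of_tendsto hc.tendsto (by
    filter_upwards [self_mem_nhdsWithin] with t ht using (h.pos t ht).le)

/-- The ends are the nearest zeros on either side of `x`, or `α` and `β` when there are none. As `x`
may itself be `α` or `β`, one of the two sides may degenerate; the clauses `x < β → x < b` and `α <
x → a < x` ensure that not both do. -/
theorem exists_isPosInterval {f : ℝ → ℝ} {α β x : ℝ} (hαβ : α < β) (hf : ContinuousOn f (Icc α β))
    (hx : x ∈ Icc α β) (hfx : 0 < f x) :
    ∃ a b, IsPosInterval f α β a b ∧ x ∈ Icc a b := by
  have hright : ∃ b, x ≤ b ∧ b ≤ β ∧ (∀ t ∈ Ico x b, 0 < f t) ∧ (f b = 0 ∨ b = β) ∧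
      (x < β → x < b) := by
    by_cases hz : (Icc x β ∩ f ⁻¹' {0}).Nonempty
    · have hcl : IsCompact (Icc x β ∩ f ⁻¹' {0}) :=
        isCompact_Icc.of_isClosed_subset
          ((hf.mono (Icc_subset_Icc_left hx.1)).preimage_isClosed_of_isClosed isClosed_Icc
            isClosed_singleton) inter_subset_left
      obtain ⟨b, ⟨hb, hb0⟩, hmin⟩ := hcl.exists_isLeast hz
      have hb0 : f b = 0 := hb0
      refine ⟨b, hb.1, hb.2, fun t ht => ?_, Or.inl hb0, fun _ => ?_⟩
      · by_contra hneg
        obtain ⟨z, hz, hz0⟩ := intermediate_value_Icc' ht.1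
          (hf.mono (Icc_subset_Icc hx.1 (ht.2.le.trans hb.2))) ⟨not_lt.1 hneg, hfx.le⟩
        have := hmin ⟨⟨hz.1, hz.2.trans (ht.2.le.trans hb.2)⟩, hz0⟩
        linarith [hz.2, ht.2]
      · exact lt_of_le_of_ne hb.1 fun h => by rw [← h] at hb0; linarith
    · refine ⟨β, hx.2, le_rfl, fun t ht => ?_, Or.inr rfl, id⟩
      by_contra hneg
      obtain ⟨z, hz', hz0⟩ := intermediate_value_Icc' ht.1
        (hf.mono (Icc_subset_Icc hx.1 ht.2.le)) ⟨not_lt.1 hneg, hfx.le⟩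
      exact hz ⟨z, ⟨hz'.1, hz'.2.trans ht.2.le⟩, hz0⟩
  have hleft : ∃ a, a ≤ x ∧ α ≤ a ∧ (∀ t ∈ Ioc a x, 0 < f t) ∧ (f a = 0 ∨ a = α) ∧
      (α < x → a < x) := by
    by_cases hz : (Icc α x ∩ f ⁻¹' {0}).Nonempty
    · have hcl : IsCompact (Icc α x ∩ f ⁻¹' {0}) :=
        isCompact_Icc.of_isClosed_subset
          ((hf.mono (Icc_subset_Icc_right hx.2)).preimage_isClosed_of_isClosed isClosed_Icc
            isClosed_singleton) inter_subset_left
      obtain ⟨b, ⟨hb, hb0⟩, hmax⟩ := hcl.exists_isGreatest hz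
      have hb0 : f b = 0 := hb0
      refine ⟨b, hb.2, hb.1, fun t ht => ?_, Or.inl hb0, fun _ => ?_⟩
      · by_contra hneg
        obtain ⟨z, hz, hz0⟩ := intermediate_value_Icc ht.2
          (hf.mono (Icc_subset_Icc (hb.1.trans ht.1.le) hx.2)) ⟨not_lt.1 hneg, hfx.le⟩
        have := hmax ⟨⟨(hb.1.trans ht.1.le).trans hz.1, hz.2⟩, hz0⟩
        linarith [hz.1, ht.1]
      · exact lt_of_le_of_ne hb.2 fun h => by rw [h] at hb0; linarith
    · refine ⟨α, hx.1, le_rfl, fun t ht => ?_, Or.inr rfl, id⟩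
      by_contra hneg
      obtain ⟨z, hz', hz0⟩ := intermediate_value_Icc ht.2
        (hf.mono (Icc_subset_Icc ht.1.le hx.2)) ⟨not_lt.1 hneg, hfx.le⟩
      exact hz ⟨z, ⟨ht.1.le.trans hz'.1, hz'.2⟩, hz0⟩
  obtain ⟨b, hxb, hbβ, hposb, hb, hxb'⟩ := hright
  obtain ⟨a, hax, haα, hposa, ha, hax'⟩ := hleft
  refine ⟨a, b, ⟨haα, ?_, hbβ, fun t ht => ?_, ha, hb⟩, hax, hxb⟩
  · rcases hx.2.lt_or_eq with h | h
    · exact hax.trans_lt (hxb' h)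
    · exact (hax' (h ▸ hαβ)).trans_le hxb
  · rcases le_total t x with h | h
    · exact hposa t ⟨ht.1, h⟩
    · exact hposb t ⟨h, ht.2⟩

/-- Around the points of an alternation there are ordered maximal intervals of constant sign. -/
theorem exists_ordered_isPosInterval {f : ℝ → ℝ} {y : ℕ → ℝ} {α β : ℝ} {k : ℕ} (hαβ : α < β)
    (hf : ContinuousOn f (Icc α β)) (h1 : ∀ i < k, y i ∈ Icc α β) (h2 : ∀ i < k, f (y i) ≠ 0)
    (h3 : ∀ i, i + 1 < k → y i < y (i + 1) ∧ f (y i) * f (y (i + 1)) < 0) :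
    ∃ a b : ℕ → ℝ, (∀ i < k, IsPosInterval (fun t => f (y i) * f t) α β (a i) (b i)) ∧
      ∀ i, i + 1 < k → b i ≤ a (i + 1) := by
  have hex : ∀ i, ∃ a b, i < k →
      IsPosInterval (fun t => f (y i) * f t) α β a b ∧ y i ∈ Icc a b := by
    intro i
    by_cases hi : i < k
    · obtain ⟨a, b, h⟩ := exists_isPosInterval (f := fun t => f (y i) * f t) hαβ
        (continuousOn_const.mul hf) (h1 i hi) (mul_self_pos.2 (h2 i hi))
      exact ⟨a, b, fun _ => h⟩
    · exact ⟨0, 0, fun h => absurd h hi⟩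
  choose a b hab using hex
  refine ⟨a, b, fun i hi => (hab i hi).1, fun i hi => ?_⟩
  obtain ⟨hi1, hm1⟩ := hab i (by omega)
  obtain ⟨hi2, hm2⟩ := hab (i + 1) hi
  by_contra! hlt
  -- Overlapping intervals would share a point where `f` has the signs of both `f (y i)` and `f (y
  -- (i + 1))`.
  have hmax : max (a i) (a (i + 1)) < min (b i) (b (i + 1)) := by
    have := (h3 i hi).1
    exact max_lt (lt_min hi1.lt (by linarith [hm1.1, hm2.2])) (lt_min hlt hi2.lt)
  obtain ⟨t, ht1, ht2⟩ := exists_between hmax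
  rw [max_lt_iff] at ht1
  rw [lt_min_iff] at ht2
  have p1 := hi1.pos t ⟨ht1.1, ht2.1⟩
  have p2 := hi2.pos t ⟨ht1.2, ht2.2⟩
  have := (h3 i hi).2
  nlinarith [mul_pos p1 p2, mul_nonneg (mul_self_nonneg (f t)) (neg_pos.2 this).le]

theorem derivWithin_nonneg_of_left_zero {f : ℝ → ℝ} {s : Set ℝ} {a b d : ℝ} (hab : a < b)
    (hs : Ioo a b ⊆ s) (hd : HasDerivWithinAt f d s a) (ha : f a = 0)
    (hpos : ∀ t ∈ Ioo a b, 0 < f t) : 0 ≤ d := by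
  have h1 := (hasDerivWithinAt_iff_tendsto_slope' (s := Ioo a b) (by simp)).1 (hd.mono hs)
  have := left_nhdsWithin_Ioo_neBot hab
  refine ge_of_tendsto h1 ?_
  filter_upwards [self_mem_nhdsWithin] with t ht
  rw [slope_def_field, ha, sub_zero]
  exact div_nonneg (hpos t ht).le (by linarith [ht.1])

theorem derivWithin_nonpos_of_right_zero {f : ℝ → ℝ} {s : Set ℝ} {a b d : ℝ} (hab : a < b)
    (hs : Ioo a b ⊆ s) (hd : HasDerivWithinAt f d s b) (hb : f b = 0)
    (hpos : ∀ t ∈ Ioo a b, 0 < f t) : d ≤ 0 := by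
  have h1 := (hasDerivWithinAt_iff_tendsto_slope' (s := Ioo a b) (by simp)).1 (hd.mono hs)
  have := right_nhdsWithin_Ioo_neBot hab
  refine le_of_tendsto h1 ?_
  filter_upwards [self_mem_nhdsWithin] with t ht
  rw [slope_def_field, hb, sub_zero]
  exact div_nonpos_of_nonneg_of_nonpos (hpos t ht).le (by linarith [ht.2])

/-- Between two points of opposite signs, a smooth function without zeros of infinite order has a
zero of odd order at which it changes sign. -/
theorem exists_signChange {f : ℝ → ℝ} {α β x y : ℝ} (hf : ContDiffOn ℝ ∞ f (Icc α β))
    (hfin : ∀ ξ ∈ Icc α β, ∃ p, iteratedDerivWithin p f (Icc α β) ξ ≠ 0) (hx : x ∈ Icc α β)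
    (hy : y ∈ Icc α β) (hxy : x < y) (hneg : f x * f y < 0) :
    ∃ ξ ∈ Ioo x y, ξ ∈ signChangePoints f α β ∧ f ξ = 0 ∧ Odd (zeroMultiplicity f ξ) := by
  have hfx : f x ≠ 0 := fun h => by simp [h] at hneg
  have hsub : Icc x y ⊆ Icc α β := Icc_subset_Icc hx.1 hy.2
  have hcont : ContinuousOn f (Icc x y) := hf.continuousOn.mono hsub
  -- the first point before which `f` keeps the weak sign of `f x`
  let S : Set ℝ := {t | t ∈ Icc x y ∧ ∀ u ∈ Icc x t, 0 ≤ f x * f u}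
  have hxS : x ∈ S := ⟨⟨le_rfl, hxy.le⟩, fun u hu => by
    rw [le_antisymm hu.2 hu.1]; exact mul_self_nonneg _⟩
  have hbdd : BddAbove S := ⟨y, fun t ht => ht.1.2⟩
  set ξ := sSup S
  have hξ1 : x ≤ ξ := le_csSup hbdd hxS
  have hξ2 : ξ ≤ y := csSup_le ⟨x, hxS⟩ fun t ht => ht.1.2
  have hlow : ∀ u, x ≤ u → u < ξ → 0 ≤ f x * f u := fun u hu1 hu2 => by
    obtain ⟨t, ht, hut⟩ := exists_lt_of_lt_csSup ⟨x, hxS⟩ hu2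
    exact ht.2 u ⟨hu1, hut.le⟩
  -- By maximality of `ξ`, points of strictly opposite sign occur arbitrarily close to `ξ` on its
  -- right.
  have hup : ∀ v, ξ < v → v ≤ y → ∃ u, ξ ≤ u ∧ u ≤ v ∧ f x * f u < 0 := fun v hv hvy => by
    by_contra! hcon
    have : v ∈ S := ⟨⟨hξ1.trans hv.le, hvy⟩, fun u hu => by
      rcases lt_or_ge u ξ with h | h
      · exact hlow u hu.1 h
      · exact hcon u h hu.2⟩
    exact absurd (le_csSup hbdd this) (not_le.2 hv)
  have hξm : ξ ∈ Icc α β := hsub ⟨hξ1, hξ2⟩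
  have hnear {g : ℝ} (hg : 0 < g * f ξ) : ∀ᶠ u in 𝓝[Icc α β] ξ, 0 < g * f u :=
    ((continuousOn_const.mul hf.continuousOn) ξ hξm).eventually (lt_mem_nhds hg)
  have hzero : f ξ = 0 := by
    by_contra hne
    rcases lt_or_gt_of_ne (mul_ne_zero hfx hne) with h | h
    · have hxξ : x < ξ := lt_of_le_of_ne hξ1 fun h' => by
        rw [← h'] at h; exact absurd (mul_self_nonneg (f x)) (not_le.2 h)
      have := hnear (g := -f x) (by linarith)
      rw [eventually_nhdsWithin_iff, Metric.eventually_nhds_iff] at this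
      obtain ⟨ε, hε, hb⟩ := this
      obtain ⟨u, hu1, hu2⟩ := exists_between (max_lt hxξ (sub_lt_self ξ hε))
      rw [max_lt_iff] at hu1
      have h1 := hb (y := u) (by rw [Real.dist_eq, abs_lt]; constructor <;> linarith)
        (hsub ⟨hu1.1.le, hu2.le.trans hξ2⟩)
      have h2 := hlow u hu1.1.le hu2
      linarith
    · have hξy : ξ < y := lt_of_le_of_ne hξ2 fun h' => by
        rw [h'] at h; linarith
      have := hnear h
      rw [eventually_nhdsWithin_iff, Metric.eventually_nhds_iff] at this
      obtain ⟨ε, hε, hb⟩ := this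
      obtain ⟨v, hv1, hv2⟩ := exists_between (lt_min hξy (lt_add_of_pos_right ξ hε))
      rw [lt_min_iff] at hv2
      obtain ⟨u, hu1, hu2, hu3⟩ := hup v hv1 hv2.1.le
      have h1 := hb (y := u) (by rw [Real.dist_eq, abs_lt]; constructor <;> linarith)
        (hsub ⟨hξ1.trans hu1, hu2.trans hv2.1.le⟩)
      linarith
  have hxξ : x < ξ := lt_of_le_of_ne hξ1 fun h => hfx (h ▸ hzero)
  have hξy : ξ < y := lt_of_le_of_ne hξ2 fun h => by rw [← h, hzero, mul_zero] at hneg; linarith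
  have hξo : ξ ∈ Ioo α β := ⟨hx.1.trans_lt hxξ, hξy.trans_le hy.2⟩
  have hiter (p : ℕ) : iteratedDerivWithin p f (Icc α β) ξ = iteratedDeriv p f ξ :=
    iteratedDerivWithin_eq_iteratedDeriv (uniqueDiffOn_Icc (hξo.1.trans hξo.2))
      ((hf.contDiffAt (Icc_mem_nhds hξo.1 hξo.2)).of_le (mod_cast le_top)) hξm
  -- Finite order makes the multiplicity a genuine minimum rather than the default value `0` of
  -- `sInf ∅`.
  have hset : {p : ℕ | iteratedDeriv p f ξ ≠ 0}.Nonempty := by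
    obtain ⟨p, hp⟩ := hfin ξ hξm
    exact ⟨p, by rwa [mem_ofPred_eq, ← hiter]⟩
  have hpm : iteratedDeriv (zeroMultiplicity f ξ) f ξ ≠ 0 := Nat.sInf_mem hset
  have hev := eventually_pos_leading_term_mul (p := zeroMultiplicity f ξ) (convex_Icc α β) hξm hf
    (by rwa [hiter]) fun q hq => by
      rw [hiter]
      by_contra h
      exact Nat.notMem_of_lt_sInf hq h
  rw [hiter, nhdsWithin_eq_nhds.2 (Icc_mem_nhds hξo.1 hξo.2), Metric.eventually_nhds_iff] at hev
  set p := zeroMultiplicity f ξ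
  set c := iteratedDeriv p f ξ
  obtain ⟨ε, hε, hb⟩ := hev
  have hsign (t : ℝ) (ht1 : ξ - ε < t) (ht2 : t < ξ + ε) (hne : t ≠ ξ) :
      0 < c * (t - ξ) ^ p * f t :=
    hb (by rw [Real.dist_eq, abs_lt]; constructor <;> linarith) hne
  have hright (t : ℝ) (ht1 : ξ < t) (ht2 : t < ξ + ε) : 0 < c * f t := by
    have h1 := hsign t (by linarith) ht2 ht1.ne'
    have h2 : 0 < (t - ξ) ^ p := pow_pos (by linarith) _
    have h3 : c * (t - ξ) ^ p * f t = (t - ξ) ^ p * (c * f t) := by ring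
    rw [h3] at h1
    exact (mul_pos_iff_of_pos_left h2).1 h1
  have hcx : c * f x < 0 := by
    obtain ⟨v, hv1, hv2⟩ := exists_between (lt_min hξy (lt_add_of_pos_right ξ hε))
    rw [lt_min_iff] at hv2
    obtain ⟨u, hu1, hu2, hu3⟩ := hup v hv1 hv2.1.le
    have hne : ξ ≠ u := fun h => by rw [← h, hzero, mul_zero] at hu3; linarith
    have h1 := hright u (lt_of_le_of_ne hu1 hne) (by linarith)
    by_contra! h0
    nlinarith [mul_self_nonneg (f u), mul_neg_of_pos_of_neg h1 hu3,
      mul_nonneg h0 (mul_self_nonneg (f u))]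
  -- An even order would give `f` the same sign on both sides of `ξ`, whereas it is weakly that of
  -- `f x` on the left and strictly opposite on the right.
  have hodd : Odd p := by
    by_contra heven
    rw [Nat.not_odd_iff_even] at heven
    obtain ⟨u, hu1, hu2⟩ := exists_between (max_lt hxξ (sub_lt_self ξ hε))
    rw [max_lt_iff] at hu1
    have h1 := hsign u hu1.2 (by linarith) hu2.ne
    have h2 := hlow u hu1.1.le hu2
    have h3 : 0 ≤ (u - ξ) ^ p := heven.pow_nonneg _
    have h4 : c * (u - ξ) ^ p * f u = (u - ξ) ^ p * (c * f u) := by ring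
    rw [h4] at h1
    have h5 : 0 < c * f u := by
      by_contra! h6
      exact absurd (mul_nonpos_of_nonneg_of_nonpos h3 h6) (not_le.2 h1)
    nlinarith [mul_nonneg h2 h5.le, mul_self_nonneg (f u), mul_pos (neg_pos.2 hcx) (mul_self_pos.2
      (show f u ≠ 0 from fun h => by simp [h] at h5))]
  refine ⟨ξ, ⟨hxξ, hξy⟩, ⟨hξo, ε, hε, fun u hu v hv => ?_⟩, hzero, hodd⟩
  have h1 := hsign u hu.1 (by linarith [hu.2]) hu.2.ne
  have h2 := hright v hv.1 hv.2
  have h3 : (u - ξ) ^ p < 0 := hodd.pow_neg (by linarith [hu.2])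
  have h4 : c * (u - ξ) ^ p * f u = (u - ξ) ^ p * (c * f u) := by ring
  rw [h4] at h1
  have h5 : c * f u < 0 := by
    by_contra! h6
    exact absurd (mul_nonpos_of_nonpos_of_nonneg h3.le h6) (not_le.2 h1)
  by_contra! h6
  nlinarith [mul_neg_of_neg_of_pos h5 h2, mul_nonneg (mul_self_nonneg c) h6]

/-- A smooth function on `[α, β]` without zeros of infinite order has finitely many zeros. -/
theorem finite_zeros {f : ℝ → ℝ} {α β : ℝ} (hf : ContDiffOn ℝ ∞ f (Icc α β))
    (hfin : ∀ ξ ∈ Icc α β, ∃ p, iteratedDerivWithin p f (Icc α β) ξ ≠ 0) :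
    (zeros f α β).Finite := by
  classical
  by_contra hinf
  -- Zeros might accumulate at `α` or `β`, hence the finite order hypothesis on the closed interval,
  -- with derivatives taken within it.
  obtain ⟨ξ, hξ, hacc⟩ := Set.Infinite.exists_accPt_of_subset_isCompact hinf isCompact_Icc
    (fun ξ hξ => Ioo_subset_Icc_self hξ.1)
  have hev := eventually_pos_leading_term_mul (convex_Icc α β) hξ hf
    (Nat.find_spec (hfin ξ hξ)) fun q hq => not_not.1 (Nat.find_min (hfin ξ hξ) hq)
  rw [accPt_iff_frequently] at hacc
  rw [eventually_nhdsWithin_iff] at hev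
  obtain ⟨t, ⟨hne, ht⟩, h⟩ := (hacc.and_eventually hev).exists
  have := h (Ioo_subset_Icc_self ht.1) hne
  rw [ht.2, mul_zero] at this
  exact lt_irrefl _ this

/-- An alternation produces as many sign changes, each at a zero of odd multiplicity. -/
theorem Alternates.sign_changes {f : ℝ → ℝ} {α β : ℝ} {k : ℕ} (hf : ContDiffOn ℝ ∞ f (Icc α β))
    (hfin : ∀ ξ ∈ Icc α β, ∃ p, iteratedDerivWithin p f (Icc α β) ξ ≠ 0)
    (halt : Alternates f α β (k + 1)) :
    k ≤ (signChangePoints f α β).ncard ∧ k ≤ numSignChanges f α β := by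
  obtain ⟨x, h1, h2, h3⟩ := halt
  have hex : ∀ i, ∃ ξ, i < k → ξ ∈ Ioo (x i) (x (i + 1)) ∧
      ξ ∈ signChangePoints f α β ∧ f ξ = 0 ∧ Odd (zeroMultiplicity f ξ) := by
    intro i
    by_cases hi : i < k
    · obtain ⟨ξ, hξ, h⟩ := exists_signChange hf hfin (h1 i (by omega)) (h1 (i + 1) (by omega))
        (h3 i (by omega)).1 (h3 i (by omega)).2
      exact ⟨ξ, fun _ => ⟨hξ, h⟩⟩
    · exact ⟨0, fun h => absurd h hi⟩
  choose ξ hξ using hex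
  have hmono : ∀ i j, i ≤ j → j ≤ k → x i ≤ x j := fun i j hij hj => by
    induction j, hij using Nat.le_induction with
    | base => exact le_rfl
    | succ j hij ih => exact (ih (by omega)).trans (h3 j (by omega)).1.le
  have hlt : ∀ i j, i < j → j < k → ξ i < ξ j := fun i j hij hj =>
    ((hξ i (by omega)).1.2.trans_le (hmono (i + 1) j hij hj.le)).trans (hξ j hj).1.1
  have hinj : InjOn ξ (Iio k) := fun i hi j hj h => by
    rcases lt_trichotomy i j with h' | h' | h'
    · exact absurd h (hlt i j h' hj).ne
    · exact h'
    · exact absurd h (hlt j i h' hi).ne'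
  have hcard : (ξ '' Iio k).ncard = k := by
    rw [hinj.ncard_image, ← Finset.coe_Iio, ncard_coe_finset, Nat.card_Iio]
  have hz := finite_zeros hf hfin
  constructor
  · rw [← hcard]
    refine ncard_le_ncard ?_ (hz.subset ?_)
    · rintro _ ⟨i, hi, rfl⟩
      exact (hξ i hi).2.1
    -- Comparing `ncard` needs a finite set. The definition of a sign change says nothing of `f t`;
    -- continuity makes `t` a zero.
    · rintro t ⟨ht, ε, hε, hsgn⟩
      refine ⟨ht, ?_⟩
      by_contra hne
      have hc : ContinuousAt f t := hf.continuousOn.continuousAt (Icc_mem_nhds ht.1 ht.2)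
      have hev : ∀ᶠ u in 𝓝 t, 0 < f t * f u :=
        (continuousAt_const.mul hc).eventually (lt_mem_nhds (mul_self_pos.2 hne))
      obtain ⟨δ, hδ, hb⟩ := Metric.eventually_nhds_iff.1 hev
      obtain ⟨r, hr0, hr⟩ := exists_between (lt_min hε hδ)
      rw [lt_min_iff] at hr
      have hu := hb (y := t - r) (by rw [Real.dist_eq, abs_lt]; constructor <;> linarith)
      have hv := hb (y := t + r) (by rw [Real.dist_eq, abs_lt]; constructor <;> linarith)
      have := hsgn (t - r) ⟨by linarith, by linarith⟩ (t + r) ⟨by linarith, by linarith⟩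
      nlinarith [mul_pos hu hv, mul_nonneg (mul_self_nonneg (f t)) (neg_pos.2 this).le]
  · rw [← hcard]
    refine ncard_le_ncard ?_ (hz.subset fun t ht => ht.1)
    rintro _ ⟨i, hi, rfl⟩
    exact ⟨⟨(hξ i hi).2.1.1, (hξ i hi).2.2.1⟩, (hξ i hi).2.2.2⟩

/-! ### Inhomogeneous Sturm–Liouville problems -/

/-- The coefficients are smooth and positive on `[α, β]`. -/
structure RegularCoeffs (K G L : ℝ → ℝ) (α β : ℝ) : Prop where
  lt : α < β
  smoothK : ContDiffOn ℝ ∞ K (Icc α β)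
  smoothG : ContDiffOn ℝ ∞ G (Icc α β)
  smoothL : ContDiffOn ℝ ∞ L (Icc α β)
  posK : ∀ x ∈ Icc α β, 0 < K x
  posG : ∀ x ∈ Icc α β, 0 < G x
  posL : ∀ x ∈ Icc α β, 0 < L x

/-- `Y` solves `(K Y')' + G F - L Y = 0` on `[α, β]` with the two boundary conditions, and `P` is
its flux `K Y'`. -/
structure IsSolution (K G L : ℝ → ℝ) (α β : ℝ) (h H : ENNReal) (Y P F : ℝ → ℝ) : Prop where
  hasDeriv : ∀ x ∈ Icc α β, HasDerivWithinAt Y (P x / K x) (Icc α β) x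
  hasDeriv_flux : ∀ x ∈ Icc α β, HasDerivWithinAt P (L x * Y x - G x * F x) (Icc α β) x
  left : h ≠ ⊤ → P α = h.toReal * Y α
  left_dirichlet : h = ⊤ → Y α = 0
  right : H ≠ ⊤ → P β = -(H.toReal * Y β)
  right_dirichlet : H = ⊤ → Y β = 0

variable {K G L : ℝ → ℝ} {α β : ℝ} {h H : ENNReal} {Y P F U V Q : ℝ → ℝ} {ρ σ ξ : ℝ}

theorem IsSolution.continuousOn (hY : IsSolution K G L α β h H Y P F) :
    ContinuousOn Y (Icc α β) := fun x hx => (hY.hasDeriv x hx).continuousWithinAt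

theorem IsSolution.continuousOn_flux (hY : IsSolution K G L α β h H Y P F) :
    ContinuousOn P (Icc α β) := fun x hx => (hY.hasDeriv_flux x hx).continuousWithinAt

theorem IsSolution.const_mul (hY : IsSolution K G L α β h H Y P F) (c : ℝ) :
    IsSolution K G L α β h H (fun x => c * Y x) (fun x => c * P x) (fun x => c * F x) where
  hasDeriv x hx := by
    have := (hY.hasDeriv x hx).const_mul c
    rwa [← mul_div_assoc] at this
  hasDeriv_flux x hx := by
    have := (hY.hasDeriv_flux x hx).const_mul c
    convert! this using 1; ring
  left hh := by rw [hY.left hh]; ring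
  left_dirichlet hh := by rw [hY.left_dirichlet hh, mul_zero]
  right hh := by rw [hY.right hh]; ring
  right_dirichlet hh := by rw [hY.right_dirichlet hh, mul_zero]

theorem IsSolution.sum {s : Finset ℕ} {Y P F : ℕ → ℝ → ℝ}
    (hY : ∀ j ∈ s, IsSolution K G L α β h H (Y j) (P j) (F j)) :
    IsSolution K G L α β h H (fun x => ∑ j ∈ s, Y j x) (fun x => ∑ j ∈ s, P j x)
      (fun x => ∑ j ∈ s, F j x) where
  hasDeriv x hx := by
    rw [Finset.sum_div]
    exact HasDerivWithinAt.fun_sum fun j hj => (hY j hj).hasDeriv x hx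
  hasDeriv_flux x hx := by
    rw [Finset.mul_sum, Finset.mul_sum, ← Finset.sum_sub_distrib]
    exact HasDerivWithinAt.fun_sum fun j hj => (hY j hj).hasDeriv_flux x hx
  left hh := by
    rw [Finset.mul_sum]
    exact Finset.sum_congr rfl fun j hj => (hY j hj).left hh
  left_dirichlet hh := Finset.sum_eq_zero fun j hj => (hY j hj).left_dirichlet hh
  right hh := by
    rw [Finset.mul_sum, ← Finset.sum_neg_distrib]
    exact Finset.sum_congr rfl fun j hj => (hY j hj).right hh
  right_dirichlet hh := Finset.sum_eq_zero fun j hj => (hY j hj).right_dirichlet hh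

theorem IsEigenfunction.isSolution (hc : RegularCoeffs K G L α β)
    (hV : IsEigenfunction K G L α β h H ρ V) :
    IsSolution K G L α β h H V (fun x => K x * derivWithin V (Icc α β) x)
      (fun x => ρ * V x) where
  hasDeriv x hx := by
    rw [mul_div_cancel_left₀ _ (hc.posK x hx).ne']
    exact (hV.contDiffOn.differentiableOn (by norm_num) x hx).hasDerivWithinAt
  hasDeriv_flux x hx := by
    have hd : ContDiffOn ℝ 1 (derivWithin V (Icc α β)) (Icc α β) :=
      hV.contDiffOn.derivWithin (uniqueDiffOn_Icc hc.lt) (by norm_num)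
    have hd2 := ((hc.smoothK.of_le (mod_cast le_top)).mul hd).differentiableOn one_ne_zero x hx
    have h1 := hd2.hasDerivWithinAt
    convert! h1 using 1
    have := hV.equation x hx
    change _ = derivWithin (fun y => K y * derivWithin V (Icc α β) y) (Icc α β) x
    linarith
  left hh := by linarith [hV.leftBC.1 hh]
  left_dirichlet hh := hV.leftBC.2 hh
  right hh := by linarith [hV.rightBC.1 hh]
  right_dirichlet hh := hV.rightBC.2 hh

theorem IsSolution.flux_left_nonneg (hc : RegularCoeffs K G L α β)
    (hY : IsSolution K G L α β h H Y P F) {a b : ℝ} (hab : IsPosInterval Y α β a b) (ha : Y a = 0) :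
    0 ≤ P a := by
  have ham : a ∈ Icc α β := hab.mem_Icc ⟨le_rfl, hab.lt.le⟩
  have h1 := derivWithin_nonneg_of_left_zero hab.lt
    (fun t ht => hab.mem_Icc ⟨ht.1.le, ht.2.le⟩) (hY.hasDeriv a ham) ha hab.pos
  have h2 := mul_nonneg h1 (hc.posK a ham).le
  rwa [div_mul_cancel₀ _ (hc.posK a ham).ne'] at h2

theorem IsSolution.flux_right_nonpos (hc : RegularCoeffs K G L α β)
    (hY : IsSolution K G L α β h H Y P F) {a b : ℝ} (hab : IsPosInterval Y α β a b) (hb : Y b = 0) :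
    P b ≤ 0 := by
  have hbm : b ∈ Icc α β := hab.mem_Icc ⟨hab.lt.le, le_rfl⟩
  have h1 := derivWithin_nonpos_of_right_zero hab.lt
    (fun t ht => hab.mem_Icc ⟨ht.1.le, ht.2.le⟩) (hY.hasDeriv b hbm) hb hab.pos
  have h2 := mul_nonpos_of_nonpos_of_nonneg h1 (hc.posK b hbm).le
  rwa [div_mul_cancel₀ _ (hc.posK b hbm).ne'] at h2

/-- On a maximal interval of positivity of `Y`, the source term is somewhere positive. -/
theorem IsSolution.exists_source_pos (hc : RegularCoeffs K G L α β)
    (hY : IsSolution K G L α β h H Y P F) {a b : ℝ} (hab : IsPosInterval Y α β a b) :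
    ∃ y ∈ Ioo a b, 0 < F y := by
  by_contra! hF
  have hsub : Icc a b ⊆ Icc α β := fun t ht => hab.mem_Icc ht
  -- If `F ≤ 0`, then `P' = L Y - G F > 0`, which is incompatible with `P a ≥ 0 ≥ P b`.
  have hmono : StrictMonoOn P (Icc a b) := by
    refine strictMonoOn_of_hasDerivWithinAt_pos (convex_Icc a b) (hY.continuousOn_flux.mono hsub)
      (f' := fun x => L x * Y x - G x * F x) (fun x hx => ?_) fun x hx => ?_
    · rw [interior_Icc] at hx ⊢
      exact (hY.hasDeriv_flux x (hsub (Ioo_subset_Icc_self hx))).mono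
        (Ioo_subset_Icc_self.trans hsub)
    · rw [interior_Icc] at hx
      have hxm := hsub (Ioo_subset_Icc_self hx)
      have h1 := mul_pos (hc.posL x hxm) (hab.pos x hx)
      have h2 := mul_nonpos_of_nonneg_of_nonpos (hc.posG x hxm).le (hF x hx)
      linarith
  have hPa : 0 ≤ P a := by
    by_cases ha : Y a = 0
    · exact hY.flux_left_nonneg hc hab ha
    · obtain rfl : a = α := hab.left.resolve_left ha
      have hh : h ≠ ⊤ := fun hh => ha (hY.left_dirichlet hh)
      rw [hY.left hh]
      exact mul_nonneg ENNReal.toReal_nonneg (hab.nonneg hY.continuousOn ⟨le_rfl, hab.lt.le⟩)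
  have hPb : P b ≤ 0 := by
    by_cases hb : Y b = 0
    · exact hY.flux_right_nonpos hc hab hb
    · obtain rfl : b = β := hab.right.resolve_left hb
      have hh : H ≠ ⊤ := fun hh => hb (hY.right_dirichlet hh)
      rw [hY.right hh]
      exact neg_nonpos.2 (mul_nonneg ENNReal.toReal_nonneg
        (hab.nonneg hY.continuousOn ⟨hab.lt.le, le_rfl⟩))
  have := hmono ⟨le_rfl, hab.lt.le⟩ ⟨hab.lt.le, le_rfl⟩ hab.lt
  linarith

/-- The source term has at least as many sign alternations as the solution. -/
theorem IsSolution.alternates_source (hc : RegularCoeffs K G L α β)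
    (hY : IsSolution K G L α β h H Y P F) {k : ℕ} (halt : Alternates Y α β k) :
    Alternates F α β k := by
  obtain ⟨x, h1, h2, h3⟩ := halt
  obtain ⟨a, b, hab, hord⟩ := exists_ordered_isPosInterval hc.lt hY.continuousOn h1 h2 h3
  have hex : ∀ i, ∃ y, i < k → y ∈ Ioo (a i) (b i) ∧ 0 < Y (x i) * F y := by
    intro i
    by_cases hi : i < k
    -- The factor `Y (x i)` reduces intervals of either sign to the positive case.
    · obtain ⟨y, hy, hF⟩ := (hY.const_mul (Y (x i))).exists_source_pos hc (hab i hi)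
      exact ⟨y, fun _ => ⟨hy, hF⟩⟩
    · exact ⟨0, fun h => absurd h hi⟩
  choose y hy using hex
  refine ⟨y, fun i hi => (hab i hi).mem_Icc (Ioo_subset_Icc_self (hy i hi).1),
    fun i hi h0 => ?_, fun i hi => ⟨?_, ?_⟩⟩
  · have := (hy i hi).2
    rw [h0, mul_zero] at this
    exact lt_irrefl _ this
  · exact ((hy i (by omega)).1.2.trans_le (hord i hi)).trans (hy (i + 1) hi).1.1
  · have p1 := (hy i (by omega)).2
    have p2 := (hy (i + 1) hi).2
    by_contra! h0
    nlinarith [mul_pos p1 p2, mul_nonneg h0 (neg_pos.2 (h3 i hi).2).le]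

/-! ### Eigenfunctions: positivity, uniqueness, Sturm comparison, ordering -/

/-- Every eigenvalue is positive. -/
theorem IsEigenfunction.pos (hc : RegularCoeffs K G L α β)
    (hV : IsEigenfunction K G L α β h H ρ V) : 0 < ρ := by
  obtain ⟨x, hx, hne⟩ := hV.nontrivial
  have hsol := (hV.isSolution hc).const_mul (V x)
  obtain ⟨a, b, hab, -⟩ := exists_isPosInterval hc.lt hsol.continuousOn hx (mul_self_pos.2 hne)
  obtain ⟨y, hy, hF⟩ := hsol.exists_source_pos hc hab
  have := hab.pos y hy
  rw [mul_left_comm] at hF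
  exact (pos_iff_pos_of_mul_pos hF).2 this

/-- A solution of the homogeneous equation with vanishing Cauchy data is zero. -/
theorem IsSolution.eq_zero (hc : RegularCoeffs K G L α β)
    (hV : IsSolution K G L α β h H V P (fun x => ρ * V x)) (hξ : ξ ∈ Icc α β) (h0 : V ξ = 0)
    (h1 : P ξ = 0) : ∀ x ∈ Icc α β, V x = 0 := by
  have hcont : ContinuousOn (fun x => 1 / K x + L x - ρ * G x) (Icc α β) :=
    ((continuousOn_const.div hc.smoothK.continuousOn fun x hx => (hc.posK x hx).ne').add
      hc.smoothL.continuousOn).sub (continuousOn_const.mul hc.smoothG.continuousOn)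
  obtain ⟨C, hC⟩ := isCompact_Icc.exists_bound_of_continuousOn hcont
  -- Grönwall's argument: `|E'| ≤ C * E`, so `E * exp (-C x)` decreases and `E * exp (C x)`
  -- increases; the first handles the right of `ξ`, the second the left.
  let E : ℝ → ℝ := fun x => V x ^ 2 + P x ^ 2
  have hE0 : E ξ = 0 := by simp [E, h0, h1]
  have hEnn (x : ℝ) : 0 ≤ E x := by positivity
  have hder (s : ℝ) (x : ℝ) (hx : x ∈ Icc α β) :
      HasDerivWithinAt (fun t => E t * Real.exp (s * t))
        ((2 * (V x * P x) * (1 / K x + L x - ρ * G x) + s * E x) * Real.exp (s * x))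
        (Icc α β) x := by
    have hd1 := ((hV.hasDeriv x hx).pow 2).add ((hV.hasDeriv_flux x hx).pow 2)
    have hd2 : HasDerivWithinAt (fun t => Real.exp (s * t)) (Real.exp (s * x) * s)
        (Icc α β) x := by
      simpa using (((hasDerivAt_id x).const_mul s).exp).hasDerivWithinAt
    convert! hd1.mul hd2 using 1
    simp [E]
    ring
  have hbound (x : ℝ) (hx : x ∈ Icc α β) :
      |2 * (V x * P x) * (1 / K x + L x - ρ * G x)| ≤ C * E x := by
    have h2 : |2 * (V x * P x)| ≤ E x := by
      rw [abs_le]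
      constructor <;> simp only [E] <;> nlinarith [sq_nonneg (V x + P x), sq_nonneg (V x - P x)]
    have h3 := hC x hx
    rw [Real.norm_eq_abs] at h3
    rw [abs_mul, mul_comm]
    exact mul_le_mul h3 h2 (abs_nonneg _) ((abs_nonneg _).trans h3)
  have hcontE (s : ℝ) : ContinuousOn (fun t => E t * Real.exp (s * t)) (Icc α β) :=
    fun x hx => (hder s x hx).continuousWithinAt
  have hanti : AntitoneOn (fun t => E t * Real.exp (-C * t)) (Icc α β) := by
    refine antitoneOn_of_hasDerivWithinAt_nonpos (convex_Icc α β) (hcontE _)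
      (fun x hx => (hder (-C) x (interior_subset hx)).mono interior_subset) fun x hx => ?_
    have := le_of_abs_le (hbound x (interior_subset hx))
    exact mul_nonpos_of_nonpos_of_nonneg (by linarith) (Real.exp_pos _).le
  have hmono : MonotoneOn (fun t => E t * Real.exp (C * t)) (Icc α β) := by
    refine monotoneOn_of_hasDerivWithinAt_nonneg (convex_Icc α β) (hcontE _)
      (fun x hx => (hder C x (interior_subset hx)).mono interior_subset) fun x hx => ?_
    have := neg_le_of_abs_le (hbound x (interior_subset hx))
    exact mul_nonneg (by linarith) (Real.exp_pos _).le
  intro x hx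
  have hEx : E x ≤ 0 := by
    rcases le_total ξ x with hle | hle
    · have := hanti hξ hx hle
      simp only [hE0, zero_mul] at this
      exact nonpos_of_mul_nonpos_left this (Real.exp_pos _)
    · have := hmono hx hξ hle
      simp only [hE0, zero_mul] at this
      exact nonpos_of_mul_nonpos_left this (Real.exp_pos _)
  have : V x ^ 2 ≤ 0 := by
    have : E x = V x ^ 2 + P x ^ 2 := rfl
    nlinarith [sq_nonneg (P x)]
  exact pow_eq_zero_iff two_ne_zero |>.1 (le_antisymm this (sq_nonneg _))

/-- Sturm's comparison on a maximal interval of positivity: an eigenfunction for a larger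
eigenvalue takes negative values there. -/
theorem IsSolution.exists_neg_of_lt (hc : RegularCoeffs K G L α β)
    (hU : IsSolution K G L α β h H U P (fun x => ρ * U x))
    (hV : IsSolution K G L α β h H V Q (fun x => σ * V x)) (hρσ : ρ < σ)
    (hne : ∃ x ∈ Icc α β, V x ≠ 0) {a b : ℝ} (hab : IsPosInterval U α β a b) :
    ∃ y ∈ Ioo a b, V y < 0 := by
  by_contra! hnn
  have hsub : Icc a b ⊆ Icc α β := fun t ht => hab.mem_Icc ht
  have hVnn : ∀ x ∈ Icc a b, 0 ≤ V x := fun x hx => by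
    have : (𝓝[Ioo a b] x).NeBot := by
      rwa [← mem_closure_iff_nhdsWithin_neBot, closure_Ioo hab.lt.ne]
    exact ge_of_tendsto ((hV.continuousOn x (hsub hx)).mono (Ioo_subset_Icc_self.trans hsub))
      (by filter_upwards [self_mem_nhdsWithin] with t ht using hnn t ht)
  -- The Wronskian satisfies `W' = (σ - ρ) G U V`. If `V ≥ 0` it is nondecreasing with `W a ≥ 0 ≥ W
  -- b`, hence zero; then `V = 0` on `]a, b[`, and everywhere by uniqueness.
  let W : ℝ → ℝ := fun x => P x * V x - Q x * U x
  have hW : ∀ x ∈ Icc α β, HasDerivWithinAt W ((σ - ρ) * G x * U x * V x) (Icc α β) x := by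
    intro x hx
    convert! ((hU.hasDeriv_flux x hx).mul (hV.hasDeriv x hx)).sub
      ((hV.hasDeriv_flux x hx).mul (hU.hasDeriv x hx)) using 1
    ring
  have hmono : MonotoneOn W (Icc a b) := by
    refine monotoneOn_of_hasDerivWithinAt_nonneg (convex_Icc a b)
      (f' := fun x => (σ - ρ) * G x * U x * V x)
      (fun x hx => (hW x (hsub hx)).continuousWithinAt.mono hsub)
      (fun x hx => (hW x (hsub (interior_subset hx))).mono (interior_subset.trans hsub))
      fun x hx => ?_
    rw [interior_Icc] at hx
    exact mul_nonneg (mul_nonneg (mul_nonneg (sub_pos.2 hρσ).le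
      (hc.posG x (hsub (Ioo_subset_Icc_self hx))).le) (hab.pos x hx).le) (hnn x hx)
  have hWa : 0 ≤ W a := by
    by_cases ha : U a = 0
    · have := mul_nonneg (hU.flux_left_nonneg hc hab ha) (hVnn a ⟨le_rfl, hab.lt.le⟩)
      simpa [W, ha] using this
    -- `U` and `V` satisfy the same non-Dirichlet condition here, so `W` vanishes.
    · obtain rfl : a = α := hab.left.resolve_left ha
      have hh : h ≠ ⊤ := fun hh => ha (hU.left_dirichlet hh)
      simp only [W, hU.left hh, hV.left hh]
      exact le_of_eq (by ring)
  have hWb : W b ≤ 0 := by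
    by_cases hb : U b = 0
    · have := mul_nonpos_of_nonpos_of_nonneg (hU.flux_right_nonpos hc hab hb)
        (hVnn b ⟨hab.lt.le, le_rfl⟩)
      simpa [W, hb] using this
    · obtain rfl : b = β := hab.right.resolve_left hb
      have hh : H ≠ ⊤ := fun hh => hb (hU.right_dirichlet hh)
      simp only [W, hU.right hh, hV.right hh]
      exact le_of_eq (by ring)
  have hW0 : ∀ x ∈ Ioo a b, W x = 0 := fun x hx => le_antisymm
    ((hmono (Ioo_subset_Icc_self hx) ⟨hab.lt.le, le_rfl⟩ hx.2.le).trans hWb)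
    (hWa.trans (hmono ⟨le_rfl, hab.lt.le⟩ (Ioo_subset_Icc_self hx) hx.1.le))
  have hunique {f : ℝ → ℝ} {d x : ℝ} (hx : x ∈ Ioo a b) (hf : ∀ t ∈ Ioo a b, f t = 0)
      (hd : HasDerivWithinAt f d (Icc α β) x) : d = 0 := by
    have hd1 := hd.hasDerivAt (mem_of_superset (Ioo_mem_nhds hx.1 hx.2)
      (Ioo_subset_Icc_self.trans hsub))
    have hd2 : HasDerivAt f 0 x := (hasDerivAt_const x (0 : ℝ)).congr_of_eventuallyEq
      (by filter_upwards [Ioo_mem_nhds hx.1 hx.2] with t ht using hf t ht)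
    exact hd1.unique hd2
  have hV0 : ∀ x ∈ Ioo a b, V x = 0 := fun x hx => by
    have hxm := hsub (Ioo_subset_Icc_self hx)
    have h1 := hunique hx hW0 (hW x hxm)
    exact (mul_eq_zero.1 h1).resolve_left (mul_pos (mul_pos (sub_pos.2 hρσ) (hc.posG x hxm))
      (hab.pos x hx)).ne'
  obtain ⟨ξ, hξ1, hξ2⟩ := exists_between hab.lt
  have hξm := hsub (Ioo_subset_Icc_self ⟨hξ1, hξ2⟩)
  have hQ := hunique ⟨hξ1, hξ2⟩ hV0 (hV.hasDeriv ξ hξm)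
  obtain ⟨x, hx, hx0⟩ := hne
  exact hx0 (hV.eq_zero hc hξm (hV0 ξ ⟨hξ1, hξ2⟩)
    ((div_eq_zero_iff.1 hQ).resolve_right (hc.posK ξ hξm).ne') x hx)

/-- An eigenfunction for a larger eigenvalue has at least one more sign alternation. -/
theorem IsEigenfunction.alternates_succ (hc : RegularCoeffs K G L α β)
    (hU : IsEigenfunction K G L α β h H ρ U) (hV : IsEigenfunction K G L α β h H σ V)
    (hρσ : ρ < σ) {k : ℕ} (hk : 0 < k) (halt : Alternates U α β k) :
    Alternates V α β (k + 1) := by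
  obtain ⟨x, h1, h2, h3⟩ := halt
  have hUs := hU.isSolution hc
  have hVs := hV.isSolution hc
  obtain ⟨a, b, hab, hord⟩ := exists_ordered_isPosInterval hc.lt hUs.continuousOn h1 h2 h3
  have hUc (c : ℝ) : IsSolution K G L α β h H (fun x => c * U x)
      (fun x => c * (K x * derivWithin U (Icc α β) x)) (fun x => ρ * (c * U x)) := by
    convert! hUs.const_mul c using 2; ring
  have hVc : IsSolution K G L α β h H (fun x => -1 * V x)
      (fun x => -1 * (K x * derivWithin V (Icc α β) x)) (fun x => σ * (-1 * V x)) := by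
    convert! hVs.const_mul (-1) using 2; ring
  -- Comparison with both `V` and `-V` shows that `V` takes both signs on each interval. Two points
  -- from the first interval and one from each other give `k + 1`.
  have hex : ∀ i, ∃ p q, i < k → p ∈ Ioo (a i) (b i) ∧ q ∈ Ioo (a i) (b i) ∧ 0 < V p ∧ V q < 0 := by
    intro i
    by_cases hi : i < k
    · obtain ⟨q, hq, hVq⟩ := (hUc (U (x i))).exists_neg_of_lt hc hVs hρσ hV.nontrivial (hab i hi)
      obtain ⟨p, hp, hVp⟩ := (hUc (U (x i))).exists_neg_of_lt hc hVc hρσ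
        (hV.nontrivial.imp fun t ht => ⟨ht.1, mul_ne_zero (by norm_num) ht.2⟩) (hab i hi)
      exact ⟨p, q, fun _ => ⟨hp, hq, by linarith, hVq⟩⟩
    · exact ⟨0, 0, fun h => absurd h hi⟩
  choose p q hpq using hex
  -- choose the sign so that a point of the opposite sign lies to the left in the first interval
  have key : ∃ s : ℝ, ∃ z : ℝ, ∃ y : ℕ → ℝ, z ∈ Ioo (a 0) (b 0) ∧ z < y 0 ∧ s * V z < 0 ∧
      ∀ i < k, y i ∈ Ioo (a i) (b i) ∧ 0 < s * (-1) ^ i * V (y i) := by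
    rcases lt_trichotomy (q 0) (p 0) with hlt | heq | hlt
    · refine ⟨1, q 0, fun i => if Even i then p i else q i, (hpq 0 hk).2.1, by simpa using hlt,
        by linarith [(hpq 0 hk).2.2.2], fun i hi => ?_⟩
      obtain ⟨e1, e2, e3, e4⟩ := hpq i hi
      rcases Nat.even_or_odd i with he | ho
      · simpa [he, he.neg_one_pow] using ⟨e1, e3⟩
      · simpa [Nat.not_even_iff_odd.2 ho, ho.neg_one_pow] using ⟨e2, e4⟩
    · have := (hpq 0 hk).2.2
      rw [heq] at this
      linarith [this.1, this.2]
    · refine ⟨-1, p 0, fun i => if Even i then q i else p i, (hpq 0 hk).1, by simpa using hlt,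
        by linarith [(hpq 0 hk).2.2.1], fun i hi => ?_⟩
      obtain ⟨e1, e2, e3, e4⟩ := hpq i hi
      rcases Nat.even_or_odd i with he | ho
      · simpa [he, he.neg_one_pow] using ⟨e2, e4⟩
      · simpa [Nat.not_even_iff_odd.2 ho, ho.neg_one_pow] using ⟨e1, e3⟩
  obtain ⟨s, z, y, hz, hzy, hsz, hy⟩ := key
  refine ⟨fun i => Nat.casesOn i z y, fun i hi => ?_, fun i hi h0 => ?_, fun i hi => ?_⟩
  · cases i with
    | zero => exact (hab 0 hk).mem_Icc (Ioo_subset_Icc_self hz)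
    | succ i => exact (hab i (by omega)).mem_Icc (Ioo_subset_Icc_self (hy i (by omega)).1)
  · cases i with
    | zero =>
      change V z = 0 at h0
      rw [h0, mul_zero] at hsz
      exact lt_irrefl _ hsz
    | succ i =>
      have := (hy i (by omega)).2
      change V (y i) = 0 at h0
      rw [h0, mul_zero] at this
      exact lt_irrefl _ this
  · cases i with
    | zero =>
      refine ⟨hzy, ?_⟩
      have := (hy 0 hk).2
      simp only [pow_zero, mul_one] at this
      change V z * V (y 0) < 0
      by_contra! h0
      nlinarith [mul_neg_of_neg_of_pos hsz this, mul_nonneg (mul_self_nonneg s) h0]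
    | succ i =>
      refine ⟨((hy i (by omega)).1.2.trans_le (hord i (by omega))).trans
        (hy (i + 1) (by omega)).1.1, ?_⟩
      have e1 := (hy i (by omega)).2
      have e2 := (hy (i + 1) (by omega)).2
      rw [pow_succ] at e2
      change V (y i) * V (y (i + 1)) < 0
      by_contra! h0
      nlinarith [mul_pos e1 e2, mul_nonneg (mul_self_nonneg (s * (-1) ^ i)) h0]

/-- A `j`-th eigenfunction takes alternating signs at `j` points. -/
theorem IsNthEigenvalue.alternates (hc : RegularCoeffs K G L α β) {j : ℕ}
    (hj : IsNthEigenvalue K G L α β h H j ρ) (hV : IsEigenfunction K G L α β h H ρ V) :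
    Alternates V α β j := by
  induction j generalizing ρ V with
  | zero => exact ⟨fun _ => 0, by simp, by simp, by simp⟩
  | succ j ih =>
    rcases Nat.eq_zero_or_pos j with rfl | hpos
    · obtain ⟨x, hx, hne⟩ := hV.nontrivial
      exact ⟨fun _ => x, fun _ _ => hx, fun _ _ => hne, fun i hi => absurd hi (by omega)⟩
    · set S := {r : ℝ | r < ρ ∧ IsEigenvalue K G L α β h H r}
      have hS : S.encard = (j : ℕ∞) := by
        have := hj.2
        push_cast at this
        exact (ENat.add_left_injective_of_ne_top ENat.one_ne_top) this
      have hfin : S.Finite := finite_of_encard_eq_coe hS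
      have hnon : S.Nonempty := by
        rw [← encard_pos, hS]; exact_mod_cast hpos
      -- The largest eigenvalue below `ρ` is the `j`-th: removing it from `S` leaves exactly those
      -- below it.
      obtain ⟨r, hr, hmax⟩ := hfin.exists_maximal hnon
      obtain ⟨U, hU⟩ := hr.2
      refine hU.alternates_succ hc hV hr.1 hpos (ih ⟨hr.2, ?_⟩ hU)
      have hSr : {r' : ℝ | r' < r ∧ IsEigenvalue K G L α β h H r'} = S \ {r} := by
        ext t
        constructor
        · rintro ⟨ht, hte⟩
          exact ⟨⟨ht.trans hr.1, hte⟩, ht.ne⟩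
        · rintro ⟨⟨ht, hte⟩, hne⟩
          refine ⟨lt_of_not_ge fun hle => ?_, hte⟩
          exact hne (le_antisymm (hmax ⟨ht, hte⟩ hle) hle)
      rw [hSr, encard_sdiff_singleton_add_one hr, hS]

/-- By counting: if `σ ≤ ρ`, the eigenvalues below `σ` are among those below `ρ`, so `j ≤ i`. -/
theorem IsNthEigenvalue.lt {i j : ℕ} (hi : IsNthEigenvalue K G L α β h H i ρ)
    (hj : IsNthEigenvalue K G L α β h H j σ) (hij : i < j) : ρ < σ := by
  by_contra! hle
  have hsub : {r : ℝ | r < σ ∧ IsEigenvalue K G L α β h H r} ⊆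
      {r : ℝ | r < ρ ∧ IsEigenvalue K G L α β h H r} := fun r hr => ⟨hr.1.trans_le hle, hr.2⟩
  have := add_le_add_left (encard_le_encard hsub) 1
  rw [hi.2, hj.2] at this
  exact absurd (Nat.cast_le.1 this) (by omega)

/-! ### Smoothness and zeros of infinite order -/

/-- Bootstrap on the first-order system `V' = P / K`, `P' = (L - ρ G) V`: each pass gains one
derivative for both functions. -/
theorem IsSolution.contDiffOn (hc : RegularCoeffs K G L α β)
    (hV : IsSolution K G L α β h H V P (fun x => ρ * V x)) :
    ContDiffOn ℝ ∞ V (Icc α β) ∧ ContDiffOn ℝ ∞ P (Icc α β) := by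
  have hu := uniqueDiffOn_Icc hc.lt
  have key : ∀ n : ℕ, ContDiffOn ℝ n V (Icc α β) ∧ ContDiffOn ℝ n P (Icc α β) := by
    intro n
    induction n with
    | zero =>
      exact ⟨contDiffOn_zero.2 hV.continuousOn, contDiffOn_zero.2 hV.continuousOn_flux⟩
    | succ n ih =>
      have hle : (n : WithTop ℕ∞) ≤ ∞ := mod_cast le_top
      push_cast
      rw [contDiffOn_succ_iff_derivWithin hu, contDiffOn_succ_iff_derivWithin hu]
      refine ⟨⟨fun x hx => (hV.hasDeriv x hx).differentiableWithinAt, by simp, ?_⟩,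
        fun x hx => (hV.hasDeriv_flux x hx).differentiableWithinAt, by simp, ?_⟩
      · exact (ih.2.div (hc.smoothK.of_le hle) fun x hx => (hc.posK x hx).ne').congr
          fun x hx => (hV.hasDeriv x hx).derivWithin (hu x hx)
      · exact (((hc.smoothL.of_le hle).mul ih.1).sub
          ((hc.smoothG.of_le hle).mul (contDiffOn_const.mul ih.1))).congr
          fun x hx => (hV.hasDeriv_flux x hx).derivWithin (hu x hx)
  exact ⟨contDiffOn_infty.2 fun n => (key n).1, contDiffOn_infty.2 fun n => (key n).2⟩

/-- All derivatives of `f` within `s` vanish at `ξ`. -/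
def FlatAt (f : ℝ → ℝ) (s : Set ℝ) (ξ : ℝ) : Prop :=
  ∀ p, iteratedDerivWithin p f s ξ = 0

section FlatAt

variable {f g : ℝ → ℝ} {s : Set ℝ}

theorem FlatAt.eq_zero (hf : FlatAt f s ξ) : f ξ = 0 := by simpa using hf 0

theorem FlatAt.congr (hf : FlatAt f s ξ) (hξ : ξ ∈ s) (hfg : EqOn g f s) : FlatAt g s ξ :=
  fun p => by rw [iteratedDerivWithin_congr hfg hξ, hf p]

theorem FlatAt.derivWithin (hf : FlatAt f s ξ) : FlatAt (derivWithin f s) s ξ := fun p => by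
  rw [← iteratedDerivWithin_succ', hf]

theorem FlatAt.mul (hs : UniqueDiffOn ℝ s) (hξ : ξ ∈ s) (hf : ContDiffOn ℝ ∞ f s)
    (hg : ContDiffOn ℝ ∞ g s) (hflat : FlatAt g s ξ) : FlatAt (f * g) s ξ := fun p => by
  have hle : (p : WithTop ℕ∞) ≤ ∞ := mod_cast le_top
  rw [iteratedDerivWithin_mul hξ hs ((hf.of_le hle) ξ hξ) ((hg.of_le hle) ξ hξ)]
  exact Finset.sum_eq_zero fun i _ => by rw [hflat, mul_zero]

theorem FlatAt.sub (hs : UniqueDiffOn ℝ s) (hξ : ξ ∈ s) (hf : ContDiffOn ℝ ∞ f s)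
    (hg : ContDiffOn ℝ ∞ g s) (hff : FlatAt f s ξ) (hgf : FlatAt g s ξ) :
    FlatAt (f - g) s ξ := fun p => by
  have hle : (p : WithTop ℕ∞) ≤ ∞ := mod_cast le_top
  rw [iteratedDerivWithin_sub hξ hs ((hf.of_le hle) ξ hξ) ((hg.of_le hle) ξ hξ), hff, hgf, sub_zero]

end FlatAt

/-- A point where a solution is flat is one where its flux and the source term are flat. -/
theorem IsSolution.flatAt (hc : RegularCoeffs K G L α β) (hY : IsSolution K G L α β h H Y P F)
    (hYs : ContDiffOn ℝ ∞ Y (Icc α β)) (hPs : ContDiffOn ℝ ∞ P (Icc α β)) (hξ : ξ ∈ Icc α β)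
    (hflat : FlatAt Y (Icc α β) ξ) : FlatAt P (Icc α β) ξ ∧ FlatAt F (Icc α β) ξ := by
  have hu := uniqueDiffOn_Icc hc.lt
  have hY's : ContDiffOn ℝ ∞ (derivWithin Y (Icc α β)) (Icc α β) :=
    ((contDiffOn_infty_iff_derivWithin hu).1 hYs).2
  have hP's : ContDiffOn ℝ ∞ (derivWithin P (Icc α β)) (Icc α β) :=
    ((contDiffOn_infty_iff_derivWithin hu).1 hPs).2
  have hP : FlatAt P (Icc α β) ξ := by
    refine (FlatAt.mul hu hξ hc.smoothK hY's hflat.derivWithin).congr hξ fun x hx => ?_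
    rw [Pi.mul_apply, (hY.hasDeriv x hx).derivWithin (hu x hx),
      mul_div_cancel₀ _ (hc.posK x hx).ne']
  refine ⟨hP, ?_⟩
  have hG : ContDiffOn ℝ ∞ (fun x => (G x)⁻¹) (Icc α β) :=
    hc.smoothG.inv fun x hx => (hc.posG x hx).ne'
  -- The equation is solved for the source: `F = (L Y - P') / G`.
  have h1 : FlatAt (L * Y - derivWithin P (Icc α β)) (Icc α β) ξ :=
    FlatAt.sub hu hξ (hc.smoothL.mul hYs) hP's (FlatAt.mul hu hξ hc.smoothL hYs hflat)
      hP.derivWithin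
  refine (FlatAt.mul hu hξ hG ((hc.smoothL.mul hYs).sub hP's) h1).congr hξ fun x hx => ?_
  have := (hc.posG x hx).ne'
  simp only [Pi.mul_apply, (hY.hasDeriv_flux x hx).derivWithin (hu x hx)]
  field_simp
  ring

/-- If all the power sums `∑ c j * r j ^ k` vanish, and the `r j` are distinct, then `c = 0`. -/
theorem eq_zero_of_forall_sum_mul_pow_eq_zero {s : Finset ℕ} {c r : ℕ → ℝ} (hr : InjOn r s)
    (hsum : ∀ k : ℕ, ∑ j ∈ s, c j * r j ^ k = 0) : ∀ j ∈ s, c j = 0 := by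
  intro i hi
  have hpoly (q : Polynomial ℝ) : ∑ j ∈ s, c j * q.eval (r j) = 0 := by
    simp_rw [Polynomial.eval_eq_sum_range, Finset.mul_sum]
    rw [Finset.sum_comm]
    refine Finset.sum_eq_zero fun k _ => ?_
    rw [← mul_zero (q.coeff k), ← hsum k, Finset.mul_sum]
    exact Finset.sum_congr rfl fun j _ => by ring
  -- This polynomial is `1` at `r i` and `0` at the other nodes, so it isolates `c i`.
  have := hpoly (Lagrange.basis s r i)
  rw [Finset.sum_eq_single i (fun j hj hne => by
    rw [Lagrange.eval_basis_of_ne hne.symm hj, mul_zero]) (fun h => absurd hi h),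
    Lagrange.eval_basis_self hr hi, mul_one] at this
  exact this

/-! ### Linear combinations of eigenfunctions -/

section LinearCombination

variable {s : Finset ℕ} {r A : ℕ → ℝ} {V : ℕ → ℝ → ℝ}

theorem isSolution_sum (hc : RegularCoeffs K G L α β)
    (hV : ∀ j ∈ s, IsEigenfunction K G L α β h H (r j) (V j)) (A : ℕ → ℝ) :
    IsSolution K G L α β h H (fun x => ∑ j ∈ s, A j * V j x)
      (fun x => ∑ j ∈ s, A j * (K x * derivWithin (V j) (Icc α β) x))
      (fun x => ∑ j ∈ s, A j * (r j * V j x)) :=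
  IsSolution.sum fun j hj => ((hV j hj).isSolution hc).const_mul (A j)

theorem contDiffOn_sum (hc : RegularCoeffs K G L α β)
    (hV : ∀ j ∈ s, IsEigenfunction K G L α β h H (r j) (V j)) (A : ℕ → ℝ) :
    ContDiffOn ℝ ∞ (fun x => ∑ j ∈ s, A j * V j x) (Icc α β) :=
  ContDiffOn.sum fun j hj =>
    contDiffOn_const.mul (((hV j hj).isSolution hc).contDiffOn hc).1

/-- A nontrivial linear combination of eigenfunctions has no zero of infinite order. -/
theorem exists_iteratedDerivWithin_sum_ne_zero (hc : RegularCoeffs K G L α β)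
    (hV : ∀ j ∈ s, IsEigenfunction K G L α β h H (r j) (V j)) (hr : InjOn r s)
    (hA : ∃ j ∈ s, A j ≠ 0) (hξ : ξ ∈ Icc α β) :
    ∃ p, iteratedDerivWithin p (fun x => ∑ j ∈ s, A j * V j x) (Icc α β) ξ ≠ 0 := by
  by_contra! hflat
  have hsol (k : ℕ) := isSolution_sum hc hV (fun j => A j * r j ^ k)
  have hPs (k : ℕ) : ContDiffOn ℝ ∞
      (fun x => ∑ j ∈ s, A j * r j ^ k * (K x * derivWithin (V j) (Icc α β) x)) (Icc α β) :=
    ContDiffOn.sum fun j hj => contDiffOn_const.mul (((hV j hj).isSolution hc).contDiffOn hc).2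
  -- Each passage to the source multiplies the `j`-th coefficient by `r j`; the values and fluxes at
  -- `ξ` thus give vanishing power sums.
  have hall (k : ℕ) : FlatAt (fun x => ∑ j ∈ s, A j * r j ^ k * V j x) (Icc α β) ξ := by
    induction k with
    | zero => simpa [FlatAt] using hflat
    | succ k ih =>
      refine ((hsol k).flatAt hc (contDiffOn_sum hc hV _) (hPs k) hξ ih).2.congr hξ fun x _ => ?_
      exact Finset.sum_congr rfl fun j _ => by ring
  have hval := eq_zero_of_forall_sum_mul_pow_eq_zero (c := fun j => A j * V j ξ) hr fun k => by
    rw [← (hall k).eq_zero]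
    exact Finset.sum_congr rfl fun j _ => by ring
  have hflux := eq_zero_of_forall_sum_mul_pow_eq_zero
    (c := fun j => A j * (K ξ * derivWithin (V j) (Icc α β) ξ)) hr fun k => by
    rw [← ((hsol k).flatAt hc (contDiffOn_sum hc hV _) (hPs k) hξ (hall k)).1.eq_zero]
    exact Finset.sum_congr rfl fun j _ => by ring
  obtain ⟨j, hj, hAj⟩ := hA
  obtain ⟨x, hx, hne⟩ := (hV j hj).nontrivial
  exact hne (((hV j hj).isSolution hc).eq_zero hc hξ ((mul_eq_zero.1 (hval j hj)).resolve_left hAj)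
    ((mul_eq_zero.1 (hflux j hj)).resolve_left hAj) x hx)

theorem Alternates.of_const_mul {f : ℝ → ℝ} {c : ℝ} {k : ℕ}
    (hf : Alternates (fun x => c * f x) α β k) : Alternates f α β k := by
  obtain ⟨x, h1, h2, h3⟩ := hf
  refine ⟨x, h1, fun i hi => right_ne_zero_of_mul (h2 i hi), fun i hi => ⟨(h3 i hi).1, ?_⟩⟩
  have := (h3 i hi).2
  by_contra! h0
  nlinarith [mul_nonneg (mul_self_nonneg c) h0]

theorem Alternates.const_mul {f : ℝ → ℝ} {c : ℝ} {k : ℕ} (hc : c ≠ 0) (hf : Alternates f α β k) :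
    Alternates (fun x => c * f x) α β k := by
  refine Alternates.of_const_mul (c := c⁻¹) ?_
  simpa [inv_mul_cancel_left₀ hc] using hf

/-- Alternation passes from a pointwise limit to the approximants. -/
theorem Alternates.exists_of_tendsto {f : ℕ → ℝ → ℝ} {g : ℝ → ℝ} {k : ℕ}
    (hg : Alternates g α β k) (hlim : ∀ x, Tendsto (fun N => f N x) atTop (𝓝 (g x))) :
    ∃ N, Alternates (f N) α β k := by
  obtain ⟨x, h1, h2, h3⟩ := hg
  have hev : ∀ᶠ N in atTop, ∀ i ∈ Finset.range k, 0 < g (x i) * f N (x i) :=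
    (Finset.eventually_all _).2 fun i hi => ((hlim (x i)).const_mul (g (x i))).eventually
      (lt_mem_nhds (mul_self_pos.2 (h2 i (Finset.mem_range.1 hi))))
  obtain ⟨N, hN⟩ := hev.exists
  refine ⟨N, x, h1, fun i hi => right_ne_zero_of_mul (hN i (Finset.mem_range.2 hi)).ne',
    fun i hi => ⟨(h3 i hi).1, ?_⟩⟩
  have p1 := hN i (Finset.mem_range.2 (by omega))
  have p2 := hN (i + 1) (Finset.mem_range.2 hi)
  by_contra! h0
  nlinarith [mul_pos p1 p2, mul_nonneg h0 (neg_pos.2 (h3 i hi).2).le]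

/-- A linear combination of eigenfunctions has at least as many alternations as its component of
lowest eigenvalue. -/
theorem Alternates.sum_of_lowest (hc : RegularCoeffs K G L α β)
    (hV : ∀ j ∈ s, IsEigenfunction K G L α β h H (r j) (V j)) {i k : ℕ} (hi : i ∈ s)
    (hAi : A i ≠ 0) (hlow : ∀ j ∈ s, j ≠ i → A j ≠ 0 → r i < r j) (halt : Alternates (V i) α β k) :
    Alternates (fun x => ∑ j ∈ s, A j * V j x) α β k := by
  have hpos : ∀ j ∈ s, 0 < r j := fun j hj => (hV j hj).pos hc
  have hlim (x : ℝ) : Tendsto (fun N : ℕ => ∑ j ∈ s, A j * (r i / r j) ^ N * V j x) atTop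
      (𝓝 (A i * V i x)) := by
    have hsum : A i * V i x = ∑ j ∈ s, if j = i then A i * V i x else 0 := by simp [hi]
    rw [hsum]
    refine tendsto_finsetSum _ fun j hj => ?_
    by_cases hji : j = i
    · subst hji
      simp [div_self (hpos j hj).ne']
    · by_cases hAj : A j = 0
      · simp [hAj, hji]
      · have hlt : r i / r j < 1 := (div_lt_one (hpos j hj)).2 (hlow j hj hji hAj)
        have := ((tendsto_pow_atTop_nhds_zero_of_lt_one
          (div_pos (hpos i hi) (hpos j hj)).le hlt).const_mul (A j)).mul_const (V j x)
        simpa [hji] using this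
  obtain ⟨N, hN⟩ := (halt.const_mul hAi).exists_of_tendsto hlim
  -- The source of the combination with exponent `M + 1` is `r i` times the one with exponent `M`,
  -- so alternations descend to exponent `0`.
  have hdesc (M : ℕ) : Alternates (fun x => ∑ j ∈ s, A j * (r i / r j) ^ M * V j x) α β k →
      Alternates (fun x => ∑ j ∈ s, A j * V j x) α β k := by
    induction M with
    | zero => simp
    | succ M ih =>
      intro hM
      refine ih (Alternates.of_const_mul (c := r i) ?_)
      have := (isSolution_sum hc hV _).alternates_source hc hM
      convert! this using 2 with x
      rw [Finset.mul_sum]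
      refine Finset.sum_congr rfl fun j hj => ?_
      have := (hpos j hj).ne'
      rw [pow_succ]
      field_simp
  exact hdesc N hN

end LinearCombination

end SturmLiouville

theorem claim3p4 (α₀ α β β₀ : ℝ) (hα₀ : α₀ < α) (hαβ : α < β) (hβ₀ : β < β₀)
    (K G L : ℝ → ℝ)
    (hK : ContDiffOn ℝ ∞ K (Set.Ioo α₀ β₀)) (hG : ContDiffOn ℝ ∞ G (Set.Ioo α₀ β₀))
    (hL : ContDiffOn ℝ ∞ L (Set.Ioo α₀ β₀))
    (hKpos : ∀ x ∈ Set.Ioo α₀ β₀, 0 < K x) (hGpos : ∀ x ∈ Set.Ioo α₀ β₀, 0 < G x)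
    (hLpos : ∀ x ∈ Set.Ioo α₀ β₀, 0 < L x)
    (h H : ENNReal)
    (m n : ℕ) (hm : 1 ≤ m) (hmn : m ≤ n)
    (V : ℕ → ℝ → ℝ)
    (hV : ∀ j ∈ Finset.Icc m n, SturmLiouville.IsNthEigenfunction K G L α β h H j (V j))
    (A : ℕ → ℝ) (hA : ∃ j ∈ Finset.Icc m n, A j ≠ 0) :
    (SturmLiouville.zeros (SturmLiouville.linComb m n A V) α β).Finite ∧
    m - 1 ≤ (SturmLiouville.signChangePoints (SturmLiouville.linComb m n A V) α β).ncard ∧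
    m - 1 ≤ SturmLiouville.numSignChanges (SturmLiouville.linComb m n A V) α β := by
  classical
  have hsub : Set.Icc α β ⊆ Set.Ioo α₀ β₀ := fun x hx =>
    ⟨hα₀.trans_le hx.1, hx.2.trans_lt hβ₀⟩
  have hc : SturmLiouville.RegularCoeffs K G L α β :=
    ⟨hαβ, hK.mono hsub, hG.mono hsub, hL.mono hsub, fun x hx => hKpos x (hsub hx),
      fun x hx => hGpos x (hsub hx), fun x hx => hLpos x (hsub hx)⟩
  have hex : ∀ j, ∃ ρ, j ∈ Finset.Icc m n → SturmLiouville.IsNthEigenvalue K G L α β h H j ρ ∧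
      SturmLiouville.IsEigenfunction K G L α β h H ρ (V j) := fun j => by
    by_cases hj : j ∈ Finset.Icc m n
    · exact (hV j hj).imp fun ρ hρ _ => hρ
    · exact ⟨0, fun h => absurd h hj⟩
  choose r hr using hex
  have heig : ∀ j ∈ Finset.Icc m n, SturmLiouville.IsEigenfunction K G L α β h H (r j) (V j) :=
    fun j hj => (hr j hj).2
  have hlt : ∀ i ∈ Finset.Icc m n, ∀ j ∈ Finset.Icc m n, i < j → r i < r j :=
    fun i hi j hj hij => (hr i hi).1.lt (hr j hj).1 hij
  have hinj : Set.InjOn r (Finset.Icc m n) := fun i hi j hj hij => by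
    rcases lt_trichotomy i j with h' | h' | h'
    · exact absurd hij (hlt i hi j hj h').ne
    · exact h'
    · exact absurd hij (hlt j hj i hi h').ne'
  have hfin : ∀ ξ ∈ Set.Icc α β, ∃ p,
      iteratedDerivWithin p (SturmLiouville.linComb m n A V) (Set.Icc α β) ξ ≠ 0 :=
    fun ξ hξ => SturmLiouville.exists_iteratedDerivWithin_sum_ne_zero hc heig hinj hA hξ
  have hsmooth : ContDiffOn ℝ ∞ (SturmLiouville.linComb m n A V) (Set.Icc α β) :=
    SturmLiouville.contDiffOn_sum hc heig A
  -- The least index with a nonzero coefficient is at least `m`, so its eigenfunction has at least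
  -- `m` alternating points, whence `m - 1` sign changes.
  obtain ⟨hi, hAi⟩ := Nat.find_spec hA
  have halt : SturmLiouville.Alternates (SturmLiouville.linComb m n A V) α β (Nat.find hA) :=
    SturmLiouville.Alternates.sum_of_lowest hc heig hi hAi (fun j hj hne hAj =>
      hlt _ hi j hj (lt_of_le_of_ne (Nat.find_min' hA ⟨hj, hAj⟩) hne.symm))
      ((hr _ hi).1.alternates hc (heig _ hi))
  refine ⟨SturmLiouville.finite_zeros hsmooth hfin, ?_⟩
  refine SturmLiouville.Alternates.sign_changes hsmooth hfin (halt.mono ?_)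
  rw [Nat.sub_add_cancel hm]
  exact (Finset.mem_Icc.1 hi).1
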